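/- A continuous $\rho:[0,\infty)\to[0,\infty)$ is of class $\mathcal K_\infty$ if $\rho(0)=0$ and $\rho$ is strictly increasing and unbounded. A continuous $\beta:[0,\infty)\times[0,\infty)\to[0,\infty)$ is of class $\mathcal{KL}_0$ if $\lim_{t\to\infty}\beta(r,t)=0$ for each $r>0$ and, for each $t\ge 0$, either $\beta(\cdot,t)\in\mathcal K_\infty$ or $\beta(\cdot,t)\equiv 0$. For $\beta\in\mathcal{KL}_0$, a final weight $\omega\ge 1$ and $K\in\mathbb N_{\ge1}$, put $$B_K(r)=\sum_{n=0}^{K-2}\beta(r,n)+\omega\,\beta(r,K-1)\qquad(r\ge0).$$ For an optimization horizon $N$ and a control horizon $m\in\{1,\dots,N-1\}$ let $$\alpha_{N,m}^\omega:=\inf_{\lambda_0,\dots,\lambda_{N-1},\,\nu}\ \frac{\sum_{n=0}^{N-2}\lambda_n+\omega\lambda_{N-1}-\nu}{\sum_{n=0}^{m-1}\lambda_n}$$ where the infimum is taken over all $\lambda_0,\dots,\lambda_{N-1},\nu>0$ with $$\sum_{n=k}^{N-2}\lambda_n+\omega\lambda_{N-1}\le B_{N-k}(\lambda_k)\quad(k=0,\dots,N-2),$$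 $$\nu\le\sum_{n=0}^{j-1}\lambda_{n+m}+B_{N-j}(\lambda_{j+m})\quad(j=0,\dots,N-m-1),$$ with the convention $\inf\emptyset=+\infty$. **Proposition 7.2.** Let $\beta\in\mathcal{KL}_0$ satisfy one of the following: 1. $\beta(r,n)=C\sigma^n r$ for all $r\ge0$, $n\in\mathbb N_0$, with constants $C\ge1$ and $\sigma\in(0,1)$, and $\omega\in\{1\}\cup[1/(1-\sigma),\infty)$; 2. $\beta(r,n)=c_n r$ for all $r\ge0$, $n\in\mathbb N_0$, with $c_n\ge0$ for all $n$ and $c_n=0$ for all $n\ge2$, and $\omega\ge1$. Then, for every $N\in\mathbb N$ and every $m\in\{1,\dots,\lfloor N/2\rfloor-1\}$, $$\alpha_{N,m+1}^\omega\ge\alpha_{N,m}^\omega .$$ Thus increasing the control horizon up to $\lfloor N/2\rfloor$ does not worsen the suboptimality bound. -/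

import Mathlib

open Set Filter Topology

/-- Class `K_∞`: continuous on `[0, ∞)`, vanishing at `0`, strictly increasing and unbounded.
(Functions on `[0, ∞)` are represented by functions on `ℝ` whose values at negative arguments
are irrelevant. Nonnegativity on `[0, ∞)` follows from the other conditions.) -/
structure IsKInfty (ρ : ℝ → ℝ) : Prop where
  continuousOn : ContinuousOn ρ (Ici 0)
  map_zero : ρ 0 = 0
  strictMonoOn : StrictMonoOn ρ (Ici 0)
  unbounded : ¬ BddAbove (ρ '' Ici 0)

/-- Class `KL_0`: continuous functions `β : [0, ∞) × [0, ∞) → [0, ∞)` with `β(r, t) → 0` as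
`t → ∞` for every `r > 0`, and such that for every `t ≥ 0` either `β(·, t)` is of class `K_∞`
or `β(·, t)` vanishes identically. -/
structure IsKLZero (β : ℝ → ℝ → ℝ) : Prop where
  nonneg : ∀ r, 0 ≤ r → ∀ t, 0 ≤ t → 0 ≤ β r t
  continuousOn : ContinuousOn (fun p : ℝ × ℝ => β p.1 p.2) (Ici 0 ×ˢ Ici 0)
  tendsto_zero : ∀ r, 0 < r → Tendsto (fun t => β r t) atTop (𝓝 0)
  kInfty_or_zero : ∀ t, 0 ≤ t → IsKInfty (fun r => β r t) ∨ ∀ r, 0 ≤ r → β r t = 0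

/-- `β ∈ KL_0` is of exponential type: `β(r, n) = C σⁿ r` for all `r ≥ 0`, `n ∈ ℕ`, with
overshoot `C ≥ 1` and decay rate `σ ∈ (0, 1)`. -/
structure IsExponentialType (β : ℝ → ℝ → ℝ) (C σ : ℝ) : Prop where
  kLZero : IsKLZero β
  one_le : 1 ≤ C
  sigma_mem : σ ∈ Ioo (0 : ℝ) 1
  eq : ∀ r, 0 ≤ r → ∀ n : ℕ, β r n = C * σ ^ n * r

/-- `β ∈ KL_0` is of finite time type: `β(r, n) = c_n r` for all `r ≥ 0`, `n ∈ ℕ`, with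
`c_n ≥ 0` and `c_n = 0` for all sufficiently large `n`. -/
structure IsFiniteTimeType (β : ℝ → ℝ → ℝ) (c : ℕ → ℝ) : Prop where
  kLZero : IsKLZero β
  nonneg : ∀ n, 0 ≤ c n
  eventually_zero : ∃ n₀ : ℕ, ∀ n, n₀ ≤ n → c n = 0
  eq : ∀ r, 0 ≤ r → ∀ n : ℕ, β r n = c n * r

/-- The bound `B_K(r) = ∑_{n=0}^{K-2} β(r, n) + ω β(r, K-1)` with final weight `ω`, for `K ≥ 1`. -/
noncomputable def finalWeightBound (β : ℝ → ℝ → ℝ) (ω : ℝ) (K : ℕ) (r : ℝ) : ℝ :=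
  ∑ n ∈ Finset.range (K - 1), β r n + ω * β r ((K - 1 : ℕ) : ℝ)

/-- Feasible points `(λ_0, …, λ_{N-1}, ν)` of the optimization problem which defines the
suboptimality bound, for optimization horizon `N`, control horizon `m ∈ {1, …, N-1}` and final
weight `ω`. Only the entries `l 0, …, l (N-1)` of the sequence `l` occur. -/
structure IsFeasible (β : ℝ → ℝ → ℝ) (ω : ℝ) (N m : ℕ) (l : ℕ → ℝ) (ν : ℝ) : Prop where
  pos : ∀ n, n < N → 0 < l n
  nu_pos : 0 < ν
  /-- `∑_{n=k}^{N-2} λ_n + ω λ_{N-1} ≤ B_{N-k}(λ_k)` for `k = 0, …, N-2`. -/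
  tail_le : ∀ k : ℕ, k + 2 ≤ N →
    ∑ n ∈ Finset.Ico k (N - 1), l n + ω * l (N - 1) ≤ finalWeightBound β ω (N - k) (l k)
  /-- `ν ≤ ∑_{n=0}^{j-1} λ_{n+m} + B_{N-j}(λ_{j+m})` for `j = 0, …, N-m-1`. -/
  nu_le : ∀ j : ℕ, j + m + 1 ≤ N →
    ν ≤ ∑ n ∈ Finset.range j, l (n + m) + finalWeightBound β ω (N - j) (l (j + m))

/-- The suboptimality bound `α_{N,m}^ω`: the infimum, over all feasible points, of
`(∑_{n=0}^{N-2} λ_n + ω λ_{N-1} - ν) / ∑_{n=0}^{m-1} λ_n`. It is taken in the extended reals,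
so that the infimum over an empty feasible set is `+∞`. -/
noncomputable def alphaBound (β : ℝ → ℝ → ℝ) (ω : ℝ) (N m : ℕ) : EReal :=
  sInf {x : EReal | ∃ (l : ℕ → ℝ) (ν : ℝ), IsFeasible β ω N m l ν ∧
    x = (((∑ n ∈ Finset.range (N - 1), l n + ω * l (N - 1) - ν) /
      ∑ n ∈ Finset.range m, l n : ℝ) : EReal)}

/-! In both cases the bound is linear, `B_K(r) = γ_K r`. Write `S_k` for the tail sums and `t = ν -
S_m`. Since `λ_k = S_k - S_{k+1}` for `k ≤ N-2`, the constraints become growth inequalities: `S_k`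
is at least `γ/(γ-1)` times `S_{k+1}` with `γ = γ_{N-k}`, and `S_{m+j} + t` is at least `γ/(γ-1)`
times `S_{m+j+1} + t` with `γ = γ_{N-j}`. The objective is `1 - t/(S_0 - S_m)`.

For `t > 0`, multiplying these inequalities gives `S_0 - S_m ≥ F_m t`, where `F_m = (P-1)(Q-1)` with
`P = tailFactor` and `Q = headFactor` (`IsFeasible.lt_and_factor_mul_le`). The value `1 - 1/F_m` is
attained once the point with equality throughout also satisfies the tail constraints with `k ≥ m`
(`alphaBound_le_of_growth`). For `t ≤ 0` the objective is at least `1`, while the infimum is at most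
`1` as soon as a feasible point exists (`IsFeasible.alphaBound_le_one`). The lower estimate for
`m+1` and attainment for `m` thus reduce the claim to `F_m ≤ F_{m+1}`
(`alphaBound_le_succ_of_growth`).

If `γ` is nonincreasing from index 2 on, which covers finite time type and `ω ≥ 1/(1-σ)`, the
comparison is elementary. For `ω = 1` and exponential type `γ` increases; there `F_m ≤ F_{m+1}`
becomes an inequality between geometric sums (`geo_sub_le`), proved by induction on the excess of
`N` over `2m+1`. Its step (`geo_step`) replaces the overshoot parameter `c = 1/C` by the endpoint `c
= 1`, where the products telescope, and by a chord bound between `c = 0` and `c = 1`. -/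

/-! ### Tail sums and growth factors -/

/-- The tail sum `∑_{n=k}^{N-2} λ_n + ω λ_{N-1}`. -/
def weightedTail (l : ℕ → ℝ) (ω : ℝ) (N k : ℕ) : ℝ :=
  ∑ n ∈ Finset.Ico k (N - 1), l n + ω * l (N - 1)

/-- The growth factor `γ_i / (γ_i - 1)`. -/
noncomputable def growth (γ : ℕ → ℝ) (i : ℕ) : ℝ := γ i / (γ i - 1)

lemma one_lt_growth {γ : ℕ → ℝ} {i : ℕ} (h : 1 < γ i) : 1 < growth γ i := by
  unfold growth
  rw [lt_div_iff₀ (by linarith)]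
  linarith

lemma one_le_prod_growth {γ : ℕ → ℝ} {a b : ℕ} (h : ∀ i, a ≤ i → i < b → 1 < γ i) :
    1 ≤ ∏ i ∈ Finset.Ico a b, growth γ i := by
  rw [← Finset.prod_const_one (s := Finset.Ico a b)]
  refine Finset.prod_le_prod (fun _ _ => zero_le_one) fun i hi => ?_
  rw [Finset.mem_Ico] at hi
  exact (one_lt_growth (h i hi.1 hi.2)).le

lemma one_lt_prod_growth {γ : ℕ → ℝ} {a b : ℕ} (hab : a < b)
    (h : ∀ i, a ≤ i → i < b → 1 < γ i) :
    1 < ∏ i ∈ Finset.Ico a b, growth γ i := by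
  rw [Finset.prod_eq_prod_Ico_succ_bot hab]
  have h1 := one_lt_growth (h a le_rfl hab)
  have h2 := one_le_prod_growth (γ := γ) (a := a + 1) (b := b) fun i hi => h i (by omega)
  nlinarith

lemma weightedTail_succ (l : ℕ → ℝ) (ω : ℝ) {N k : ℕ} (hk : k + 2 ≤ N) :
    weightedTail l ω N k = l k + weightedTail l ω N (k + 1) := by
  unfold weightedTail
  rw [Finset.sum_eq_sum_Ico_succ_bot (by omega)]
  ring

lemma weightedTail_last (l : ℕ → ℝ) (ω : ℝ) (N : ℕ) :
    weightedTail l ω N (N - 1) = ω * l (N - 1) := by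
  simp [weightedTail]

lemma sum_shift_eq_weightedTail_sub (l : ℕ → ℝ) (ω : ℝ) {N m j : ℕ} (hj : j + m + 1 ≤ N) :
    ∑ n ∈ Finset.range j, l (n + m) = weightedTail l ω N m - weightedTail l ω N (m + j) := by
  induction j with
  | zero => simp
  | succ j ih =>
    rw [Finset.sum_range_succ, ih (by omega), weightedTail_succ l ω (k := m + j) (by omega),
      Nat.add_comm j m, Nat.add_assoc]
    ring

lemma value_eq (l : ℕ → ℝ) (ω ν : ℝ) {N m : ℕ} (hm : m + 1 ≤ N) :
    (∑ n ∈ Finset.range (N - 1), l n + ω * l (N - 1) - ν) / ∑ n ∈ Finset.range m, l n =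
      (weightedTail l ω N 0 - ν) / (weightedTail l ω N 0 - weightedTail l ω N m) := by
  have h := sum_shift_eq_weightedTail_sub l ω (N := N) (m := 0) (j := m) (by omega)
  simp only [add_zero, zero_add] at h
  rw [h]
  simp [weightedTail]

/-- Iterates the one-step growth. It serves both for `f = S` and for `f j = S (m + j) + t`. -/
lemma prod_growth_mul_le {γ : ℕ → ℝ} {N J : ℕ} (f : ℕ → ℝ) (hJ : J + 1 ≤ N)
    (hγ : ∀ i, 2 ≤ i → i ≤ N → 1 < γ i)
    (hf : ∀ k, k < J → growth γ (N - k) * f (k + 1) ≤ f k) :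
    (∏ i ∈ Finset.Ico (N - J + 1) (N + 1), growth γ i) * f J ≤ f 0 := by
  induction J with
  | zero => simp
  | succ J ih =>
    have h1 := ih (by omega) fun k hk => hf k (by omega)
    have h2 := hf J (by omega)
    have h3 : N - (J + 1) + 1 = N - J := by omega
    rw [h3, Finset.prod_eq_prod_Ico_succ_bot (by omega)]
    have h4 := one_le_prod_growth (γ := γ) (a := N - J + 1) (b := N + 1)
      fun i _ _ => hγ i (by omega) (by omega)
    calc _ = (∏ i ∈ Finset.Ico (N - J + 1) (N + 1), growth γ i) *
          (growth γ (N - J) * f (J + 1)) := by ring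
      _ ≤ _ := le_trans (mul_le_mul_of_nonneg_left h2 (by linarith)) h1

/-- The largest ratio `(S_m + t) / t`, where `S_m` is the tail sum and `t = ν - S_m`. -/
noncomputable def tailFactor (γ : ℕ → ℝ) (ω : ℝ) (N m : ℕ) : ℝ :=
  γ (m + 1) / (γ (m + 1) - ω) * ∏ i ∈ Finset.Ico (m + 2) (N + 1), growth γ i

/-- The least ratio `S_0 / S_m` of tail sums. -/
noncomputable def headFactor (γ : ℕ → ℝ) (N m : ℕ) : ℝ :=
  ∏ i ∈ Finset.Ico (N - m + 1) (N + 1), growth γ i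

/-- With `y - x` as an entry of the sequence, this turns a constraint into a growth inequality. -/
lemma growth_mul_le_iff {γ : ℕ → ℝ} {i : ℕ} (h : 1 < γ i) {x y : ℝ} :
    growth γ i * x ≤ y ↔ y ≤ γ i * (y - x) := by
  unfold growth
  rw [div_mul_eq_mul_div, div_le_iff₀ (by linarith)]
  constructor <;> intro h <;> linarith

/-! ### Linear bounds: the lower estimate -/

section Linear

variable {β : ℝ → ℝ → ℝ} {ω : ℝ} {γ : ℕ → ℝ} {N m : ℕ} {l : ℕ → ℝ} {ν : ℝ}

lemma IsFeasible.weightedTail_pos (hl : IsFeasible β ω N m l ν) (hω : 1 ≤ ω) (hN : 1 ≤ N)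
    (k : ℕ) : 0 < weightedTail l ω N k := by
  unfold weightedTail
  have h1 : 0 ≤ ∑ n ∈ Finset.Ico k (N - 1), l n :=
    Finset.sum_nonneg fun n hn => (hl.pos n (by rw [Finset.mem_Ico] at hn; omega)).le
  have h2 := mul_pos (lt_of_lt_of_le one_pos hω) (hl.pos (N - 1) (by omega))
  linarith

/-- A tail sum strictly exceeds its first entry, so a constant `γ i ≤ 1` would violate the tail
constraint. -/
lemma IsFeasible.one_lt (hl : IsFeasible β ω N m l ν) (hω : 1 ≤ ω)
    (hB : ∀ K, 1 ≤ K → ∀ r, 0 ≤ r → finalWeightBound β ω K r = γ K * r)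
    {i : ℕ} (h2 : 2 ≤ i) (hi : i ≤ N) : 1 < γ i := by
  have hp := hl.pos (N - i) (by omega)
  have h := hl.tail_le (N - i) (by omega)
  rw [hB _ (by omega) _ hp.le, show N - (N - i) = i by omega] at h
  change weightedTail l ω N (N - i) ≤ _ at h
  rw [weightedTail_succ l ω (by omega)] at h
  have := hl.weightedTail_pos hω (by omega) (N - i + 1)
  by_contra! hc
  nlinarith

lemma IsFeasible.lt_and_factor_mul_le (hl : IsFeasible β ω N m l ν) (hω : 1 ≤ ω)
    (hm : m + 1 ≤ N)
    (hB : ∀ K, 1 ≤ K → ∀ r, 0 ≤ r → finalWeightBound β ω K r = γ K * r)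
    (ht : weightedTail l ω N m < ν) :
    ω < γ (m + 1) ∧
    (tailFactor γ ω N m - 1) * (headFactor γ N m - 1) * (ν - weightedTail l ω N m) ≤
      weightedTail l ω N 0 - weightedTail l ω N m := by
  set S := weightedTail l ω N with hS
  have hγ : ∀ i, 2 ≤ i → i ≤ N → 1 < γ i := fun i => hl.one_lt hω hB
  have hSpos := hl.weightedTail_pos hω (by omega)
  have hhead : headFactor γ N m * S m ≤ S 0 := by
    refine prod_growth_mul_le S hm hγ fun k hk => ?_
    rw [growth_mul_le_iff (hγ _ (by omega) (by omega))]
    have h := hl.tail_le k (by omega)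
    rw [hB _ (by omega) _ (hl.pos k (by omega)).le] at h
    change S k ≤ _ at h
    have h1 : S k = l k + S (k + 1) := weightedTail_succ l ω (by omega)
    rwa [h1, add_sub_cancel_right, ← h1]
  have hnu : ∀ j, j + m + 1 ≤ N → ν ≤ S m - S (m + j) + γ (N - j) * l (m + j) := by
    intro j hj
    have h := hl.nu_le j hj
    rw [hB _ (by omega) _ (hl.pos _ (by omega)).le,
      sum_shift_eq_weightedTail_sub l ω hj, Nat.add_comm j m] at h
    exact h
  have htail := prod_growth_mul_le (N := N) (J := N - m - 1) (γ := γ)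
    (fun j => S (m + j) + (ν - S m)) (by omega) hγ fun j hj => by
      rw [growth_mul_le_iff (hγ _ (by omega) (by omega))]
      have h := hnu j (by omega)
      have h1 : S (m + j) = l (m + j) + S (m + j + 1) := weightedTail_succ l ω (by omega)
      have h2 : S (m + j) + (ν - S m) - (S (m + (j + 1)) + (ν - S m)) = l (m + j) := by
        rw [← add_assoc, h1]; ring
      rw [h2]
      linarith
  -- The last constraint on `ν`, at the entry of weight `ω`; it produces the exceptional factor `γ
  -- (m + 1) / (γ (m + 1) - ω)`.
  have hlast := hnu (N - m - 1) (by omega)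
  have e1 : m + (N - m - 1) = N - 1 := by omega
  have e2 : N - (N - m - 1) = m + 1 := by omega
  simp only [e1, e2, add_zero] at htail hlast
  have hSl : S (N - 1) = ω * l (N - 1) := weightedTail_last l ω N
  have hlp := hl.pos (N - 1) (by omega)
  have hgap : (ν - S m) ≤ (γ (m + 1) - ω) * l (N - 1) := by linarith
  have hωγ : ω < γ (m + 1) := by
    by_contra! hc
    nlinarith
  refine ⟨hωγ, ?_⟩
  have hp : γ (m + 1) / (γ (m + 1) - ω) * (ν - S m) ≤ S (N - 1) + (ν - S m) := by
    rw [div_mul_eq_mul_div, div_le_iff₀ (by linarith), hSl]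
    nlinarith
  have hR := one_le_prod_growth (γ := γ) (a := m + 1 + 1) (b := N + 1)
    fun i _ _ => hγ i (by omega) (by omega)
  have hP : tailFactor γ ω N m * (ν - S m) ≤ S m + (ν - S m) := by
    refine le_trans ?_ htail
    unfold tailFactor
    rw [mul_right_comm, mul_comm]
    exact mul_le_mul_of_nonneg_left hp (by linarith)
  have hQ : 1 ≤ headFactor γ N m :=
    one_le_prod_growth fun i _ _ => hγ i (by omega) (by omega)
  nlinarith [mul_le_mul_of_nonneg_left hP (sub_nonneg.2 hQ)]

/-! ### Attaining the estimate -/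

/-- The sequence whose tail sums are the values of `S`. -/
noncomputable def ofTail (S : ℕ → ℝ) (ω : ℝ) (N n : ℕ) : ℝ :=
  if n + 1 < N then S n - S (n + 1) else S n / ω

lemma weightedTail_ofTail (S : ℕ → ℝ) (hω : 1 ≤ ω) {k : ℕ} (hk : k + 1 ≤ N) :
    weightedTail (ofTail S ω N) ω N k = S k := by
  obtain ⟨d, rfl⟩ : ∃ d, N = k + 1 + d := ⟨N - (k + 1), by omega⟩
  induction d generalizing k with
  | zero =>
    have : ω ≠ 0 := by positivity
    simp [weightedTail, ofTail]
    field_simp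
  | succ d ih =>
    rw [weightedTail_succ _ _ (by omega), show k + 1 + (d + 1) = k + 1 + 1 + d by omega,
      ih (k := k + 1) (by omega), ofTail, if_pos (by omega)]
    ring

lemma isFeasible_ofTail {S : ℕ → ℝ} {t : ℝ} (hω : 1 ≤ ω) (hm : m + 1 ≤ N) (ht : 0 < t)
    (hγ : ∀ i, 2 ≤ i → i ≤ N → 1 < γ i)
    (hB : ∀ K, 1 ≤ K → ∀ r, 0 ≤ r → finalWeightBound β ω K r = γ K * r)
    (hS : ∀ k, k + 1 ≤ N → 0 < S k)
    (htail : ∀ k, k + 2 ≤ N → growth γ (N - k) * S (k + 1) ≤ S k)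
    (hnu : ∀ j, j + m + 2 ≤ N → growth γ (N - j) * (S (m + j + 1) + t) ≤ S (m + j) + t)
    (hlast : S (N - 1) + t ≤ γ (m + 1) * (S (N - 1) / ω)) :
    IsFeasible β ω N m (ofTail S ω N) (S m + t) := by
  have hpos : ∀ n, n < N → 0 < ofTail S ω N n := by
    intro n hn
    unfold ofTail
    split_ifs with h
    · have h1 := htail n (by omega)
      have h2 := one_lt_growth (hγ (N - n) (by omega) (by omega))
      have h3 := hS (n + 1) (by omega)
      nlinarith
    · exact div_pos (hS n (by omega)) (by linarith)
  refine ⟨hpos, by linarith [hS m hm], fun k hk => ?_, fun j hj => ?_⟩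
  · change weightedTail (ofTail S ω N) ω N k ≤ _
    rw [weightedTail_ofTail S hω (by omega), hB _ (by omega) _ (hpos k (by omega)).le, ofTail,
      if_pos (by omega), ← growth_mul_le_iff (hγ _ (by omega) (by omega))]
    exact htail k hk
  · rw [hB _ (by omega) _ (hpos _ (by omega)).le, sum_shift_eq_weightedTail_sub _ ω hj,
      weightedTail_ofTail S hω (by omega), weightedTail_ofTail S hω (by omega), Nat.add_comm j m,
      ofTail]
    split_ifs with h
    · have h1 := hnu j (by omega)
      rw [growth_mul_le_iff (hγ _ (by omega) (by omega))] at h1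
      rw [add_sub_add_right_eq_sub] at h1
      linarith
    · obtain rfl : j = N - m - 1 := by omega
      have e1 : m + (N - m - 1) = N - 1 := by omega
      have e2 : N - (N - m - 1) = m + 1 := by omega
      rw [e1, e2]
      linarith

/-- The tail sums of an optimal point with `ν - S_m = 1`. -/
noncomputable def optimalTail (γ : ℕ → ℝ) (ω : ℝ) (N m k : ℕ) : ℝ :=
  if m ≤ k then
    γ (m + 1) / (γ (m + 1) - ω) * ∏ i ∈ Finset.Ico (m + 2) (N - (k - m) + 1), growth γ i - 1
  else
    (tailFactor γ ω N m - 1) * ∏ i ∈ Finset.Ico (N - m + 1) (N - k + 1), growth γ i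

lemma one_lt_lastFactor (hω : 1 ≤ ω) {x : ℝ} (hx : ω < x) : 1 < x / (x - ω) := by
  rw [lt_div_iff₀ (by linarith)]
  linarith

lemma one_lt_tailFactor (hω : 1 ≤ ω) (hm1 : ω < γ (m + 1))
    (hγ : ∀ i, 2 ≤ i → i ≤ N → 1 < γ i) : 1 < tailFactor γ ω N m := by
  have h1 := one_lt_lastFactor hω hm1
  have h2 := one_le_prod_growth (γ := γ) (a := m + 2) (b := N + 1)
    fun i _ _ => hγ i (by omega) (by omega)
  unfold tailFactor
  nlinarith

/-- The point `optimalTail` makes every constraint on `ν` and the tail constraints with `k < m`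
equalities. The remaining tail constraints, `k = m + j`, are exactly `hcomp` with `M = N - j`. -/
lemma alphaBound_le_of_growth (hω : 1 ≤ ω) (h : 1 ≤ m) (hm : m + 2 ≤ N)
    (hγ : ∀ i, 2 ≤ i → i ≤ N → 1 < γ i) (hm1 : ω < γ (m + 1))
    (hB : ∀ K, 1 ≤ K → ∀ r, 0 ≤ r → finalWeightBound β ω K r = γ K * r)
    (hcomp : ∀ M, m + 2 ≤ M → M ≤ N →
      growth γ (M - m) *
        (γ (m + 1) / (γ (m + 1) - ω) * ∏ i ∈ Finset.Ico (m + 2) M, growth γ i - 1) ≤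
      growth γ M *
        (γ (m + 1) / (γ (m + 1) - ω) * ∏ i ∈ Finset.Ico (m + 2) M, growth γ i) - 1) :
    alphaBound β ω N m ≤
      ((1 - 1 / ((tailFactor γ ω N m - 1) * (headFactor γ N m - 1)) : ℝ) : EReal) := by
  set S := optimalTail γ ω N m with hSdef
  have hp := one_lt_lastFactor hω hm1
  have hP := one_lt_tailFactor hω hm1 hγ
  have hSm : S m = tailFactor γ ω N m - 1 := by simp [hSdef, optimalTail, tailFactor]
  have hS0 : S 0 = (tailFactor γ ω N m - 1) * headFactor γ N m := by
    rw [hSdef, optimalTail, if_neg (by omega), headFactor, Nat.sub_zero]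
  have hSge : ∀ j, S (m + j) =
      γ (m + 1) / (γ (m + 1) - ω) * ∏ i ∈ Finset.Ico (m + 2) (N - j + 1), growth γ i - 1 := by
    intro j
    rw [hSdef, optimalTail, if_pos (by omega), Nat.add_sub_cancel_left]
  have hSle : ∀ k, k ≤ m → S k =
      (tailFactor γ ω N m - 1) * ∏ i ∈ Finset.Ico (N - m + 1) (N - k + 1), growth γ i := by
    intro k hk
    rcases hk.eq_or_lt with rfl | hk
    · simp [hSm]
    · rw [hSdef, optimalTail, if_neg (by omega)]
  have hpos : ∀ k, k + 1 ≤ N → 0 < S k := by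
    intro k hk
    rcases le_total k m with h | h
    · rw [hSle k h]
      have := one_le_prod_growth (γ := γ) (a := N - m + 1) (b := N - k + 1)
        fun i _ _ => hγ i (by omega) (by omega)
      exact mul_pos (by linarith) (by linarith)
    · obtain ⟨j, rfl⟩ := Nat.exists_eq_add_of_le h
      rw [hSge]
      have := one_le_prod_growth (γ := γ) (a := m + 2) (b := N - j + 1)
        fun i _ _ => hγ i (by omega) (by omega)
      nlinarith
  have hstep : ∀ j, j + m + 2 ≤ N → S (m + j) + 1 = growth γ (N - j) * (S (m + j + 1) + 1) := by
    intro j hj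
    rw [add_assoc m j 1, hSge, hSge, show N - (j + 1) + 1 = N - j by omega,
      Finset.prod_Ico_succ_top (by omega)]
    ring
  have hfeas : IsFeasible β ω N m (ofTail S ω N) (S m + 1) := by
    refine isFeasible_ofTail hω (by omega) one_pos hγ hB hpos (fun k hk => ?_)
      (fun j hj => (hstep j hj).ge) ?_
    · rcases lt_or_ge k m with h | h
      · rw [hSle k h.le, hSle (k + 1) h, show N - (k + 1) + 1 = N - k by omega,
          Finset.prod_Ico_succ_top (by omega)]
        exact (by ring : _ = _).le
      · obtain ⟨j, rfl⟩ := Nat.exists_eq_add_of_le h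
        have h1 := hcomp (N - j) (by omega) (by omega)
        have h2 := hstep j (by omega)
        have h3 := hSge (j + 1)
        rw [show N - (j + 1) + 1 = N - j by omega, ← add_assoc] at h3
        rw [show N - (m + j) = N - j - m by omega]
        rw [← h3] at h1
        have h4 : γ (m + 1) / (γ (m + 1) - ω) * ∏ i ∈ Finset.Ico (m + 2) (N - j), growth γ i
          = S (m + j + 1) + 1 := by linarith
        rw [h4] at h1
        linarith
    · have h1 := hSge (N - 1 - m)
      rw [show m + (N - 1 - m) = N - 1 by omega, show N - (N - 1 - m) + 1 = m + 2 by omega,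
        Finset.Ico_self, Finset.prod_empty, mul_one] at h1
      have h2 : γ (m + 1) - ω ≠ 0 := by linarith
      have h3 : ω ≠ 0 := by linarith
      rw [h1]
      apply le_of_eq
      field_simp
      ring
  refine sInf_le ⟨_, _, hfeas, ?_⟩
  rw [value_eq _ _ _ (by omega), weightedTail_ofTail S hω (by omega),
    weightedTail_ofTail S hω (by omega), hS0, hSm]
  congr 1
  have hQ : 1 < headFactor γ N m := one_lt_prod_growth (by omega)
    fun i _ _ => hγ i (by omega) (by omega)
  have h1 : tailFactor γ ω N m - 1 ≠ 0 := by linarith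
  have h2 : headFactor γ N m - 1 ≠ 0 := by linarith
  have h3 : (tailFactor γ ω N m - 1) * headFactor γ N m - (tailFactor γ ω N m - 1) =
    (tailFactor γ ω N m - 1) * (headFactor γ N m - 1) := by ring
  rw [h3]
  field_simp
  ring

/-- For `m ≥ 1` the entry `λ_0` occurs in the denominator but in no constraint on `ν`, so enlarging
it drives the quotient down to 1 or below. Feasibility for any horizon `m'` suffices, because the
tail constraints do not involve the horizon. -/
lemma IsFeasible.alphaBound_le_one {m' : ℕ} (hl : IsFeasible β ω N m' l ν) (hω : 1 ≤ ω)
    (hm : 1 ≤ m) (hmN : m + 1 ≤ N)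
    (hB : ∀ K, 1 ≤ K → ∀ r, 0 ≤ r → finalWeightBound β ω K r = γ K * r) :
    alphaBound β ω N m ≤ 1 := by
  have hγ : ∀ i, 2 ≤ i → i ≤ N → 1 < γ i := fun i => hl.one_lt hω hB
  -- The least entry serves as `ν`: since `γ > 1`, it satisfies every constraint on `ν`.
  obtain ⟨n₀, hn₀, hmin⟩ := Finset.exists_min_image (Finset.range N) l ⟨0, by simp; omega⟩
  rw [Finset.mem_range] at hn₀
  by_contra! hc
  obtain ⟨x, hx1, hx⟩ := EReal.lt_iff_exists_real_btwn.1 hc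
  replace hx1 : 1 < x := by exact_mod_cast hx1
  refine absurd hx (not_lt.2 ?_)
  set T := weightedTail l ω N 1 with hT
  have hTpos : 0 < T := hl.weightedTail_pos hω (by omega) 1
  -- The first bound preserves the tail constraint at `0`; the second gives `L + T ≤ x * L`.
  set L := max (l 0) (T / (x - 1)) with hL
  have hL0 : l 0 ≤ L := le_max_left _ _
  have hLx : T ≤ L * (x - 1) := by
    rw [← div_le_iff₀ (by linarith)]
    exact le_max_right _ _
  have hl0 := hl.pos 0 (by omega)
  set l' := Function.update l 0 L with hl'
  have hl'0 : l' 0 = L := by simp [hl']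
  have hl'n : ∀ n, n ≠ 0 → l' n = l n := fun n hn => by simp [hl', hn]
  have hS : ∀ k, 1 ≤ k → weightedTail l' ω N k = weightedTail l ω N k := by
    intro k hk
    unfold weightedTail
    rw [hl'n (N - 1) (by omega)]
    congr 1
    exact Finset.sum_congr rfl fun n hn => hl'n n (by rw [Finset.mem_Ico] at hn; omega)
  have hS0 : weightedTail l' ω N 0 = L + T := by
    rw [weightedTail_succ _ _ (by omega), hS 1 le_rfl, hl'0]
  have hpos : ∀ n, n < N → 0 < l' n := by
    intro n hn
    rcases eq_or_ne n 0 with rfl | h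
    · rw [hl'0]; linarith
    · rw [hl'n n h]; exact hl.pos n hn
  have hfeas : IsFeasible β ω N m l' (l n₀) := by
    refine ⟨hpos, hl.pos n₀ hn₀, fun k hk => ?_, fun j hj => ?_⟩
    · have h := hl.tail_le k hk
      rcases Nat.eq_zero_or_pos k with rfl | hk0
      · change weightedTail l' ω N 0 ≤ _
        change weightedTail l ω N 0 ≤ _ at h
        rw [hB _ (by omega) _ hl0.le, weightedTail_succ _ _ (by omega)] at h
        rw [hB _ (by omega) _ (hpos 0 (by omega)).le, hS0, hl'0]
        change l 0 + T ≤ _ at h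
        have := hγ (N - 0) (by omega) (by omega)
        nlinarith
      · change weightedTail l' ω N k ≤ _
        rw [hS k hk0, hl'n k (by omega)]
        exact h
    · rw [hB _ (by omega) _ (hpos _ (by omega)).le, hl'n _ (by omega)]
      have h1 : 0 ≤ ∑ n ∈ Finset.range j, l' (n + m) :=
        Finset.sum_nonneg fun n hn => (hpos _ (by rw [Finset.mem_range] at hn; omega)).le
      have h2 := hmin (j + m) (by rw [Finset.mem_range]; omega)
      have h3 := hγ (N - j) (by omega) (by omega)
      have h4 := hl.pos (j + m) (by omega)
      nlinarith
  have hle : alphaBound β ω N m ≤ _ := sInf_le ⟨_, _, hfeas, rfl⟩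
  refine hle.trans ?_
  rw [EReal.coe_le_coe_iff]
  have hden : L ≤ ∑ n ∈ Finset.range m, l' n := by
    rw [← hl'0]
    exact Finset.single_le_sum
      (fun n hn => (hpos n (by rw [Finset.mem_range] at hn; omega)).le) (by simp; omega)
  have hnum : ∑ n ∈ Finset.range (N - 1), l' n + ω * l' (N - 1) = L + T := by
    rw [← hS0]; simp [weightedTail]
  have hn0 := hl.pos n₀ hn₀
  rw [hnum, div_le_iff₀ (by linarith)]
  nlinarith

/-! ### Comparison of consecutive control horizons -/

/-- The premises of `H` are what a feasible point for `m + 1` with `ν > S_{m+1}` supplies. Without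
any feasible point the right-hand side is `+∞`. -/
lemma alphaBound_le_succ_of_growth (hω : 1 ≤ ω) (hm : 1 ≤ m) (hmN : m + 2 ≤ N)
    (hB : ∀ K, 1 ≤ K → ∀ r, 0 ≤ r → finalWeightBound β ω K r = γ K * r)
    (H : (∀ i, 2 ≤ i → i ≤ N → 1 < γ i) → ω < γ (m + 2) → ω < γ (m + 1) ∧
      (∀ M, m + 2 ≤ M → M ≤ N →
        growth γ (M - m) *
          (γ (m + 1) / (γ (m + 1) - ω) * ∏ i ∈ Finset.Ico (m + 2) M, growth γ i - 1) ≤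
        growth γ M *
          (γ (m + 1) / (γ (m + 1) - ω) * ∏ i ∈ Finset.Ico (m + 2) M, growth γ i) - 1) ∧
      (tailFactor γ ω N m - 1) * (headFactor γ N m - 1) ≤
        (tailFactor γ ω N (m + 1) - 1) * (headFactor γ N (m + 1) - 1)) :
    alphaBound β ω N m ≤ alphaBound β ω N (m + 1) := by
  refine le_sInf ?_
  rintro _ ⟨l, ν, hl, rfl⟩
  have hγ : ∀ i, 2 ≤ i → i ≤ N → 1 < γ i := fun i => hl.one_lt hω hB
  rw [value_eq _ _ _ (by omega)]
  have hD : 0 < weightedTail l ω N 0 - weightedTail l ω N (m + 1) := by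
    have h := sum_shift_eq_weightedTail_sub l ω (N := N) (m := 0) (j := m + 1) (by omega)
    rw [Nat.zero_add] at h
    rw [← h]
    exact Finset.sum_pos (fun n hn => hl.pos _ (by rw [Finset.mem_range] at hn; omega)) (by simp)
  rcases le_or_gt ν (weightedTail l ω N (m + 1)) with hν | hν
  · refine (hl.alphaBound_le_one hω hm (by omega) hB).trans ?_
    rw [← EReal.coe_one, EReal.coe_le_coe_iff, one_le_div hD]
    linarith
  · obtain ⟨hω2, hle⟩ := hl.lt_and_factor_mul_le hω (by omega) hB hν
    obtain ⟨hω1, hcomp, hmono⟩ := H hγ hω2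
    refine (alphaBound_le_of_growth hω hm hmN hγ hω1 hB hcomp).trans ?_
    rw [EReal.coe_le_coe_iff]
    have hQ : 1 < headFactor γ N m := one_lt_prod_growth (by omega)
      fun i _ _ => hγ i (by omega) (by omega)
    have hP := one_lt_tailFactor hω hω1 hγ
    have hF : 0 < (tailFactor γ ω N m - 1) * (headFactor γ N m - 1) :=
      mul_pos (by linarith) (by linarith)
    rw [show weightedTail l ω N 0 - ν = weightedTail l ω N 0 - weightedTail l ω N (m + 1) -
      (ν - weightedTail l ω N (m + 1)) by ring, sub_div, div_self hD.ne']
    refine sub_le_sub_left ?_ _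
    rw [div_le_div_iff₀ hD hF]
    nlinarith [mul_le_mul_of_nonneg_right hmono (sub_pos.2 hν).le]

/-- The difference of the two sides is `(r-1)Y(X-1) - (s-1)X(Y-1)`, which is `XY` times the
difference in `h`. -/
lemma sub_one_mul_sub_one_le {s r X Y : ℝ} (hX : 0 < X) (hY : 0 < Y)
    (h : (s - 1) * (1 - 1 / Y) ≤ (r - 1) * (1 - 1 / X)) :
    (s * X - 1) * (Y - 1) ≤ (X - 1) * (r * Y - 1) := by
  have h1 := mul_le_mul_of_nonneg_right h (mul_pos hX hY).le
  have e1 : (s - 1) * (1 - 1 / Y) * (X * Y) = (s - 1) * X * (Y - 1) := by field_simp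
  have e2 : (r - 1) * (1 - 1 / X) * (X * Y) = (r - 1) * Y * (X - 1) := by field_simp
  rw [e1, e2] at h1
  nlinarith

lemma growth_le_growth {i j : ℕ} (hj : 1 < γ j) (h : γ j ≤ γ i) : growth γ i ≤ growth γ j := by
  unfold growth
  rw [div_le_div_iff₀ (by linarith) (by linarith)]
  nlinarith

lemma headFactor_succ (hmN : m + 1 ≤ N) :
    headFactor γ N (m + 1) = growth γ (N - m) * headFactor γ N m := by
  unfold headFactor
  rw [show N - (m + 1) + 1 = N - m by omega, Finset.prod_eq_prod_Ico_succ_bot (by omega)]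

/-- Monotonicity is required only from index 2: as `m ≥ 1`, `γ 1` never enters, and for finite time
type it may be smaller than `γ 2`. -/
lemma alphaBound_le_succ_of_antitone (hω : 1 ≤ ω) (hm : 1 ≤ m) (hmN : 2 * m + 2 ≤ N)
    (hB : ∀ K, 1 ≤ K → ∀ r, 0 ≤ r → finalWeightBound β ω K r = γ K * r)
    (hanti : ∀ i j, 2 ≤ i → i ≤ j → γ j ≤ γ i) :
    alphaBound β ω N m ≤ alphaBound β ω N (m + 1) := by
  refine alphaBound_le_succ_of_growth hω hm (by omega) hB fun hγ hω2 => ?_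
  have hab := hanti (m + 1) (m + 2) (by omega) (by omega)
  have hω1 : ω < γ (m + 1) := by linarith
  have hp := one_lt_lastFactor hω hω1
  refine ⟨hω1, fun M hM hMN => ?_, ?_⟩
  · have h1 := growth_le_growth (hγ M (by omega) hMN)
      (hanti (M - m) M (by omega) (by omega))
    have h2 := one_lt_growth (hγ (M - m) (by omega) (by omega))
    have h3 := one_le_prod_growth (γ := γ) (a := m + 2) (b := M)
      fun i _ _ => hγ i (by omega) (by omega)
    have h4 : 1 ≤ γ (m + 1) / (γ (m + 1) - ω) * ∏ i ∈ Finset.Ico (m + 2) M, growth γ i := by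
      nlinarith
    nlinarith
  · rw [headFactor_succ (by omega)]
    set a := γ (m + 1)
    set b := γ (m + 2)
    set g := γ (N - m) with hg
    have hb1 : 1 < b := by linarith
    have hg1 : 1 < g := hγ _ (by omega) (by omega)
    have hgb : g ≤ b := hanti _ _ (by omega) (by omega)
    have hP' : tailFactor γ ω N (m + 1) = b / (b - ω) *
      ∏ i ∈ Finset.Ico (m + 3) (N + 1), growth γ i := rfl
    set s := a * (b - ω) / ((a - ω) * (b - 1)) with hs
    have n1 : a - ω ≠ 0 := by linarith
    have n2 : b - ω ≠ 0 := by linarith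
    have n3 : b - 1 ≠ 0 := by linarith
    have n4 : b ≠ 0 := by linarith
    have hP : tailFactor γ ω N m = s * tailFactor γ ω N (m + 1) := by
      rw [hP']
      unfold tailFactor
      rw [Finset.prod_eq_prod_Ico_succ_bot (by omega), hs]
      change a / (a - ω) * (b / (b - 1) * _) = _
      field_simp
    have hY : 1 ≤ headFactor γ N m := one_le_prod_growth
      fun i _ _ => hγ i (by omega) (by omega)
    -- Because `2m + 2 ≤ N`, every factor of `headFactor γ N m` occurs in the tail factor, whose
    -- other factors are at least 1.
    have hYX : headFactor γ N m ≤ tailFactor γ ω N (m + 1) := by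
      rw [hP', ← Finset.prod_Ico_consecutive (growth γ) (n := N - m + 1) (by omega) (by omega)]
      have h1 := one_le_prod_growth (γ := γ) (a := m + 3) (b := N - m + 1)
        fun i _ _ => hγ i (by omega) (by omega)
      have h2 := one_lt_lastFactor hω hω2
      change 1 < b / (b - ω) at h2
      rw [← mul_assoc]
      exact le_mul_of_one_le_left (zero_le_one.trans hY) (by nlinarith)
    rw [hP]
    refine sub_one_mul_sub_one_le (by linarith) (by linarith) ?_
    have hsr : s - 1 ≤ growth γ (N - m) - 1 := by
      refine sub_le_sub_right ?_ _
      refine le_trans ?_ (growth_le_growth hg1 hgb)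
      change s ≤ b / (b - 1)
      rw [hs, div_le_div_iff₀ (mul_pos (by linarith) (by linarith)) (by linarith)]
      have : a * (b - ω) ≤ b * (a - ω) := by nlinarith
      nlinarith [mul_le_mul_of_nonneg_right this (sub_pos.2 hb1).le]
    have h1 : 0 ≤ 1 - 1 / headFactor γ N m := by
      rw [sub_nonneg, div_le_one (by linarith)]; exact hY
    have h2 : 1 - 1 / headFactor γ N m ≤ 1 - 1 / tailFactor γ ω N (m + 1) :=
      sub_le_sub_left (one_div_le_one_div_of_le (by linarith) hYX) _
    have h3 := one_lt_growth (γ := γ) hg1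
    exact (mul_le_mul_of_nonneg_right hsr h1).trans
      (mul_le_mul_of_nonneg_left h2 (by linarith))

end Linear
-- Inequalities for geometric sums
section Geometric

/-- The geometric sum `1 + σ + ⋯ + σ^(n-1)`. -/
def geo (σ : ℝ) (n : ℕ) : ℝ := ∑ i ∈ Finset.range n, σ ^ i

variable {σ c : ℝ}

lemma geo_succ (σ : ℝ) (n : ℕ) : geo σ (n + 1) = geo σ n + σ ^ n := Finset.sum_range_succ _ _

lemma geo_add (σ : ℝ) (a b : ℕ) : geo σ (a + b) = geo σ a + σ ^ a * geo σ b := by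
  induction b with
  | zero => simp [geo]
  | succ b ih => rw [← add_assoc, geo_succ, geo_succ, ih]; ring

lemma geo_one (σ : ℝ) : geo σ 1 = 1 := by simp [geo]

lemma geo_succ' (σ : ℝ) (n : ℕ) : geo σ (n + 1) = 1 + σ * geo σ n := by
  rw [add_comm, geo_add, geo_one, pow_one]

lemma geo_nonneg (hσ : 0 < σ) (n : ℕ) : 0 ≤ geo σ n :=
  Finset.sum_nonneg fun _ _ => by positivity

lemma one_le_geo (hσ : 0 < σ) {n : ℕ} (hn : 1 ≤ n) : 1 ≤ geo σ n := by
  obtain ⟨k, rfl⟩ := Nat.exists_eq_add_of_le' hn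
  rw [geo_succ']
  have := mul_nonneg hσ.le (geo_nonneg hσ k)
  linarith

lemma one_lt_geo (hσ : 0 < σ) {n : ℕ} (hn : 2 ≤ n) : 1 < geo σ n := by
  obtain ⟨k, rfl⟩ := Nat.exists_eq_add_of_le' (by omega : 1 ≤ n)
  rw [geo_succ']
  have := mul_pos hσ (lt_of_lt_of_le one_pos (one_le_geo hσ (n := k) (by omega)))
  linarith

/-- Telescopes, since `1 - 1 / geo σ (i + 1) = σ * geo σ i / geo σ (i + 1)`. -/
lemma prod_one_sub_one_div_geo (hσ : 0 < σ) {a : ℕ} (ha : 1 ≤ a) (d : ℕ) :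
    ∏ i ∈ Finset.Ico (a + 1) (a + d + 1), (1 - 1 / geo σ i) =
      σ ^ d * geo σ a / geo σ (a + d) := by
  induction d with
  | zero =>
    have := one_le_geo hσ ha
    simp
    rw [div_self (by linarith)]
  | succ d ih =>
    rw [← add_assoc a d 1, Finset.prod_Ico_succ_top (by omega), ih]
    have h1 := one_le_geo hσ (n := a + d) (by omega)
    have h2 := one_le_geo hσ (n := a + d + 1) (by omega)
    have h3 : geo σ (a + d) ≠ 0 := by linarith
    have h4 : geo σ (a + d + 1) ≠ 0 := by linarith
    have h5 : 1 - 1 / geo σ (a + d + 1) = σ * geo σ (a + d) / geo σ (a + d + 1) := by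
      rw [eq_div_iff h4, sub_mul, one_div, inv_mul_cancel₀ h4, geo_succ']
      ring
    rw [h5]
    field_simp
    ring

lemma prod_one_sub_div_geo_anti (hσ : 0 < σ) (hc : c ≤ 1) {a b : ℕ} (ha : 1 ≤ a) :
    ∏ i ∈ Finset.Ico a b, (1 - 1 / geo σ i) ≤ ∏ i ∈ Finset.Ico a b, (1 - c / geo σ i) := by
  refine Finset.prod_le_prod (fun i hi => ?_) fun i hi => ?_ <;> rw [Finset.mem_Ico] at hi <;>
    have h := one_le_geo hσ (n := i) (by omega)
  · rw [sub_nonneg, div_le_one (by linarith)]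
    exact h
  · exact sub_le_sub_left (div_le_div_of_nonneg_right hc (by linarith)) _

/-- The reciprocal of `∏ (1 - c xᵢ)` lies below its chord between `c = 0` and `c = 1`. -/
lemma inv_prod_one_sub_mul_le {ι : Type*} (s : Finset ι) {x : ι → ℝ} (hc0 : 0 ≤ c) (hc1 : c ≤ 1)
    (hx : ∀ i ∈ s, 0 ≤ x i ∧ x i < 1) :
    1 ≤ (∏ i ∈ s, (1 - x i))⁻¹ ∧
      (∏ i ∈ s, (1 - c * x i))⁻¹ ≤ 1 - c + c * (∏ i ∈ s, (1 - x i))⁻¹ := by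
  classical
  induction s using Finset.induction_on with
  | empty => simp
  | insert a s ha ih =>
    obtain ⟨h1, h2⟩ := ih fun i hi => hx i (Finset.mem_insert_of_mem hi)
    obtain ⟨hx0, hx1⟩ := hx a (Finset.mem_insert_self _ _)
    rw [Finset.prod_insert ha, Finset.prod_insert ha, mul_inv, mul_inv]
    set Z := (∏ i ∈ s, (1 - x i))⁻¹
    have hcx : 0 < 1 - c * x a := by nlinarith
    have hy : 1 ≤ (1 - x a)⁻¹ := by
      rw [one_le_inv₀ (by linarith)]; linarith
    have hxi : (1 - x a) * (1 - x a)⁻¹ = 1 := mul_inv_cancel₀ (by linarith)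
    have hchord : (1 - c * x a)⁻¹ ≤ 1 - c + c * (1 - x a)⁻¹ := by
      rw [inv_le_iff_one_le_mul₀ hcx]
      set y := (1 - x a)⁻¹
      have : x a * y = y - 1 := by linarith
      have e : (1 - c + c * y) * (1 - c * x a) =
        1 + c * (1 - c) * (y - 1 - x a) := by
        linear_combination (-c ^ 2) * this
      rw [e]
      have : x a ≤ y - 1 := by nlinarith
      have := mul_nonneg (mul_nonneg hc0 (sub_nonneg.2 hc1)) (sub_nonneg.2 this)
      linarith
    refine ⟨by nlinarith, ?_⟩
    set y := (1 - x a)⁻¹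
    have h3 : 0 ≤ 1 - c + c * Z := by nlinarith
    -- The product of the two chords lies below the chord of the product: the difference is
    -- `c(1-c)(y-1)(Z-1)`.
    have h4 := mul_le_mul hchord h2 (inv_nonneg.2 (Finset.prod_nonneg fun i hi => ?_))
      (by nlinarith : 0 ≤ 1 - c + c * y)
    · have := mul_nonneg (mul_nonneg hc0 (sub_nonneg.2 hc1))
        (mul_nonneg (sub_nonneg.2 hy) (sub_nonneg.2 h1))
      nlinarith
    · have := hx i (Finset.mem_insert_of_mem hi)
      nlinarith

/-- The increment in `d` of `geo_sub_le`. After division by the first product `U`, bounding `U⁻¹` by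
its chord in `c`, and the last product and `geo σ (n + 1) - c` by their values at `c = 1`, leaves
the identity `hkey`. -/
lemma geo_step (hσ : 0 < σ) (hc0 : 0 < c) (hc1 : c ≤ 1) {n : ℕ} (hn : 1 ≤ n) (d : ℕ) :
    σ ^ (n + 1 + d) ≤
      (∏ i ∈ Finset.Ico (n + d + 2) (2 * n + d + 2), (1 - c / geo σ i)) *
        (σ ^ (n + 1 + d) + c * (σ ^ (n + d + 2) * geo σ n / geo σ (2 * n + d + 2)) +
          c / geo σ (2 * n + d + 2) * ((geo σ (n + 1) - c) *
            ∏ i ∈ Finset.Ico (n + 2) (n + d + 2), (1 - c / geo σ i))) := by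
  set K := n + 1 + d with hK
  set U := ∏ i ∈ Finset.Ico (n + d + 2) (2 * n + d + 2), (1 - c / geo σ i) with hU
  set V := ∏ i ∈ Finset.Ico (n + 2) (n + d + 2), (1 - c / geo σ i)
  have hV : σ ^ d * geo σ (n + 1) / geo σ K ≤ V := by
    rw [hK, ← prod_one_sub_one_div_geo hσ (by omega), show n + 1 + d + 1 = n + d + 2 by omega]
    exact prod_one_sub_div_geo_anti hσ hc1 (by omega)
  have hgn := one_le_geo hσ hn
  have hgK := one_le_geo hσ (n := K) (by omega)
  have hgL := one_le_geo hσ (n := 2 * n + d + 2) (by omega)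
  have hgn1 := one_le_geo hσ (n := n + 1) (by omega)
  have hU1 := prod_one_sub_one_div_geo hσ (a := K) (by omega) n
  rw [show K + 1 = n + d + 2 by omega, show K + n + 1 = 2 * n + d + 2 by omega] at hU1
  have hUpos : 0 < U := by
    refine Finset.prod_pos fun i hi => ?_
    rw [Finset.mem_Ico] at hi
    have := one_lt_geo hσ (n := i) (by omega)
    rw [sub_pos, div_lt_one (by linarith)]
    linarith
  have hUinv : U⁻¹ ≤ 1 + c * (geo σ n / (σ ^ n * geo σ K)) := by
    have h := (inv_prod_one_sub_mul_le (Finset.Ico (n + d + 2) (2 * n + d + 2))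
      (x := fun i => 1 / geo σ i) hc0.le hc1 fun i hi => by
        rw [Finset.mem_Ico] at hi
        have := one_lt_geo hσ (n := i) (by omega)
        exact ⟨by positivity, by rw [div_lt_one (by linarith)]; exact this⟩).2
    simp only [mul_one_div] at h
    refine h.trans (le_of_eq ?_)
    simp only [one_div] at hU1 ⊢
    rw [hU1, inv_div, Nat.add_comm K n, geo_add]
    have : σ ^ n ≠ 0 := by positivity
    have : geo σ K ≠ 0 := by linarith
    field_simp
    ring
  have hW : σ * geo σ n * (σ ^ d * geo σ (n + 1) / geo σ K) ≤ (geo σ (n + 1) - c) * V := by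
    refine mul_le_mul ?_ hV (by positivity) (by linarith)
    rw [geo_succ']
    linarith
  have hkey : σ ^ K * (1 + c * (geo σ n / (σ ^ n * geo σ K))) =
      σ ^ K + c * (σ ^ (n + d + 2) * geo σ n / geo σ (2 * n + d + 2)) +
        c / geo σ (2 * n + d + 2) * (σ * geo σ n * (σ ^ d * geo σ (n + 1) / geo σ K)) := by
    have hL : geo σ (2 * n + d + 2) = geo σ (n + 1) + σ ^ (n + 1) * geo σ K := by
      rw [← geo_add]; congr 1; omega
    have h1 : geo σ (2 * n + d + 2) ≠ 0 := by linarith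
    have h2 : geo σ K ≠ 0 := by linarith
    have h3 : σ ^ n ≠ 0 := by positivity
    have e1 : σ ^ K = σ ^ n * σ * σ ^ d := by rw [hK]; ring
    have e2 : σ ^ (n + d + 2) = σ ^ n * σ ^ 2 * σ ^ d := by ring
    rw [e1, e2]
    rw [pow_succ] at hL
    field_simp
    rw [hL]
    ring
  have h1 : σ ^ K * U⁻¹ ≤ σ ^ K + c * (σ ^ (n + d + 2) * geo σ n / geo σ (2 * n + d + 2)) +
        c / geo σ (2 * n + d + 2) * ((geo σ (n + 1) - c) * V) := by
    refine (mul_le_mul_of_nonneg_left hUinv (by positivity)).trans ?_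
    rw [hkey]
    exact add_le_add_right (mul_le_mul_of_nonneg_left hW (by positivity)) _
  rw [← div_eq_mul_inv, div_le_iff₀ hUpos] at h1
  linarith

/-- This is `F_m ≤ F_{m+1}` for `ω = 1` after clearing denominators, with `n = m` and `N = 2n + d +
1`. At `d = 0` both sides vanish. -/
lemma geo_sub_le (hσ : 0 < σ) (hc0 : 0 < c) (hc1 : c ≤ 1) {n : ℕ} (hn : 1 ≤ n) (d : ℕ) :
    geo σ (n + 1 + d) - geo σ (n + 1) ≤
      (geo σ (n + 1 + d) - c) *
        ∏ i ∈ Finset.Ico (n + d + 2) (2 * n + d + 2), (1 - c / geo σ i) -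
      (geo σ (n + 1) - c) * ∏ i ∈ Finset.Ico (n + 2) (2 * n + d + 2), (1 - c / geo σ i) := by
  induction d with
  | zero => simp
  | succ d ih =>
    have hstep := geo_step hσ hc0 hc1 hn d
    rw [← Finset.prod_Ico_consecutive _ (show n + 2 ≤ n + d + 2 by omega)
      (show n + d + 2 ≤ 2 * n + d + 2 by omega)] at ih
    rw [← Finset.prod_Ico_consecutive _ (show n + 2 ≤ n + (d + 1) + 2 by omega)
      (show n + (d + 1) + 2 ≤ 2 * n + (d + 1) + 2 by omega)]
    set U := ∏ i ∈ Finset.Ico (n + d + 2) (2 * n + d + 2), (1 - c / geo σ i) with hU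
    set V := ∏ i ∈ Finset.Ico (n + 2) (n + d + 2), (1 - c / geo σ i)
    set g' := geo σ (n + d + 2) with hg'
    set L := geo σ (2 * n + d + 2) with hLdef
    have hgp := one_le_geo hσ (n := n + d + 2) (by omega)
    have hLp := one_le_geo hσ (n := 2 * n + d + 2) (by omega)
    have hg0 : g' ≠ 0 := by linarith
    have hL0 : L ≠ 0 := by linarith
    rw [show n + (d + 1) + 2 = n + d + 2 + 1 by omega,
      show 2 * n + (d + 1) + 2 = 2 * n + d + 2 + 1 by omega,
      show n + 1 + (d + 1) = n + d + 2 by omega,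
      Finset.prod_Ico_succ_top (show n + 2 ≤ n + d + 2 by omega)]
    set U' := ∏ i ∈ Finset.Ico (n + d + 2 + 1) (2 * n + d + 2 + 1), (1 - c / geo σ i) with hU'
    -- From `d` to `d + 1` the window of factors loses its first one and gains a new last one.
    have hUU : (1 - c / g') * U' = U * (1 - c / L) := by
      rw [hg', hU', ← Finset.prod_eq_prod_Ico_succ_bot (f := fun i => 1 - c / geo σ i) (by omega),
        Finset.prod_Ico_succ_top (by omega)]
    have hgU : (g' - c) * U' = g' * (U * (1 - c / L)) := by
      rw [← hUU]
      field_simp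
    have hge : g' = geo σ (n + 1 + d) + σ ^ (n + 1 + d) := by
      rw [hg', ← geo_succ]; congr 1; omega
    have hLe : L = g' + σ ^ (n + d + 2) * geo σ n := by
      rw [hLdef, hg', ← geo_add]; congr 1; omega
    change g' - _ ≤ (g' - c) * U' - (geo σ (n + 1) - c) * (V * (1 - c / g') * U')
    rw [mul_assoc V, hUU, hgU]
    have e : U * (σ ^ (n + 1 + d) + c * (σ ^ (n + d + 2) * geo σ n / L) +
          c / L * ((geo σ (n + 1) - c) * V)) =
        g' * (U * (1 - c / L)) - (geo σ (n + 1) - c) * (V * (U * (1 - c / L))) -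
        ((geo σ (n + 1 + d) - c) * U - (geo σ (n + 1) - c) * (V * U)) := by
      have h1 : σ ^ (n + d + 2) * geo σ n = L - g' := by linarith
      have h2 : σ ^ (n + 1 + d) = g' - geo σ (n + 1 + d) := by linarith
      rw [h1, h2]
      field_simp
      ring
    linarith

end Geometric

/-! ### Exponential type with final weight 1 -/

section ExponentialUnitWeight

variable {β : ℝ → ℝ → ℝ} {C σ : ℝ} {N m : ℕ}

lemma prod_growth_geo (hσ : 0 < σ) (hC : 1 ≤ C) {a b : ℕ} (ha : 2 ≤ a) :
    ∏ i ∈ Finset.Ico a b, growth (fun K => C * geo σ K) i =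
      (∏ i ∈ Finset.Ico a b, (1 - 1 / C / geo σ i))⁻¹ := by
  rw [← Finset.prod_inv_distrib]
  refine Finset.prod_congr rfl fun i hi => ?_
  rw [Finset.mem_Ico] at hi
  have h1 := one_lt_geo hσ (n := i) (by omega)
  have h2 : geo σ i ≠ 0 := by linarith
  have h3 : C ≠ 0 := by linarith
  unfold growth
  rw [eq_comm, inv_eq_iff_eq_inv, inv_div]
  field_simp

lemma alphaBound_le_succ_of_exponential (hσ : 0 < σ) (hC : 1 ≤ C) (hm : 1 ≤ m)
    (hmN : 2 * m + 2 ≤ N)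
    (hB : ∀ K, 1 ≤ K → ∀ r, 0 ≤ r → finalWeightBound β 1 K r = C * geo σ K * r) :
    alphaBound β 1 N m ≤ alphaBound β 1 N (m + 1) := by
  set γ : ℕ → ℝ := fun K => C * geo σ K with hγdef
  refine alphaBound_le_succ_of_growth (γ := γ) le_rfl hm (by omega) hB fun hγ _ => ?_
  have hm1 := hγ (m + 1) (by omega) (by omega)
  set c := 1 / C with hc
  have hCc : C * c = 1 := by rw [hc]; field_simp
  have hc0 : 0 < c := by positivity
  have hc1 : c ≤ 1 := by rw [hc, div_le_one (by linarith)]; exact hC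
  have hγc : ∀ i, γ i - 1 = C * (geo σ i - c) := fun i => by
    rw [mul_sub, hCc]
  have hR : ∀ b, m + 2 ≤ b → γ (m + 1) / (γ (m + 1) - 1) *
      ∏ i ∈ Finset.Ico (m + 2) b, growth γ i = ∏ i ∈ Finset.Ico (m + 1) b, growth γ i := by
    intro b hb
    rw [Finset.prod_eq_prod_Ico_succ_bot (show m + 1 < b by omega)]
    rfl
  refine ⟨hm1, fun M hM hMN => ?_, ?_⟩
  · rw [hR M hM]
    set X := ∏ i ∈ Finset.Ico (m + 1) M, growth γ i with hX
    have hXpos : 1 ≤ X := one_le_prod_growth fun i _ _ => hγ i (by omega) (by omega)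
    have hgM := hγ M (by omega) hMN
    have hgm := hγ (M - m) (by omega) (by omega)
    -- The admissibility condition with denominators cleared. It is an equality for `C = 1`, so it
    -- suffices to compare both factors on the right with their values at `c = 1`.
    have hbound : (γ M - γ (M - m)) * X ≤ γ M - 1 := by
      obtain ⟨e, rfl⟩ := Nat.exists_eq_add_of_le hM
      have h1 := prod_one_sub_div_geo_anti hσ hc1 (a := m + 1) (b := m + (1 + e) + 1) (by omega)
      rw [prod_one_sub_one_div_geo hσ hm, show m + (1 + e) + 1 = m + 2 + e by omega] at h1
      have hg := one_le_geo hσ (n := m + (1 + e)) (by omega)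
      have hgm := one_le_geo hσ hm
      have hDpos : 0 < σ ^ (1 + e) * geo σ m / geo σ (m + (1 + e)) :=
        div_pos (mul_pos (by positivity) (by linarith)) (by linarith)
      rw [hX, prod_growth_geo hσ hC (by omega), ← div_eq_mul_inv,
        div_le_iff₀ (hDpos.trans_le h1), hγc]
      have e1 : γ (m + 2 + e) - γ (m + 2 + e - m) =
          C * (σ * geo σ (m + (1 + e)) * (σ ^ (1 + e) * geo σ m / geo σ (m + (1 + e)))) := by
        have h2 : geo σ (m + 2 + e) = geo σ (e + 2) + σ ^ (e + 2) * geo σ m := by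
          rw [← geo_add]; congr 1; omega
        have h3 : geo σ (m + (1 + e)) ≠ 0 := by linarith
        rw [hγdef]
        simp only [show m + 2 + e - m = e + 2 by omega]
        rw [h2]
        field_simp
        ring
      rw [e1, mul_assoc C]
      refine mul_le_mul_of_nonneg_left (mul_le_mul ?_ h1 hDpos.le ?_) (by linarith)
      · rw [show m + 2 + e = m + (1 + e) + 1 by omega, geo_succ']
        linarith
      · have := one_le_geo hσ (n := m + 2 + e) (by omega)
        linarith
    have hp : 0 < γ M - 1 := by linarith
    have hq : 0 < γ (M - m) - 1 := by linarith
    unfold growth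
    rw [div_mul_eq_mul_div, div_mul_eq_mul_div, div_sub_one hp.ne', div_le_div_iff₀ hq hp]
    nlinarith [mul_le_mul_of_nonneg_right hbound hp.le]
  · have hP : tailFactor γ 1 N m =
        growth γ (m + 1) * ∏ i ∈ Finset.Ico (m + 2) (N + 1), growth γ i := rfl
    have hP' : tailFactor γ 1 N (m + 1) = ∏ i ∈ Finset.Ico (m + 2) (N + 1), growth γ i := by
      rw [Finset.prod_eq_prod_Ico_succ_bot (show m + 2 < N + 1 by omega)]
      rfl
    have hX := one_le_prod_growth (γ := γ) (a := m + 2) (b := N + 1)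
      fun i _ _ => hγ i (by omega) (by omega)
    have hY : 1 ≤ headFactor γ N m := one_le_prod_growth
      fun i _ _ => hγ i (by omega) (by omega)
    rw [headFactor_succ (by omega), hP, hP']
    refine sub_one_mul_sub_one_le (by linarith) (by linarith) ?_
    unfold headFactor
    rw [prod_growth_geo hσ hC (by omega), prod_growth_geo hσ hC (by omega), ← hc]
    simp only [one_div (_⁻¹), inv_inv]
    -- Since `growth γ i - 1 = 1 / (γ i - 1)`, the goal is a rearrangement of `geo_sub_le` for this
    -- `d`.
    obtain ⟨d, rfl⟩ : ∃ d, N = 2 * m + d + 1 := ⟨N - 2 * m - 1, by omega⟩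
    have h := geo_sub_le hσ hc0 hc1 hm d
    have hg1 := hγ (m + 1 + d) (by omega) (by omega)
    rw [show 2 * m + d + 1 - m = m + 1 + d by omega, show m + 1 + d + 1 = m + d + 2 by omega,
      show 2 * m + d + 1 + 1 = 2 * m + d + 2 by omega]
    have hsub : ∀ i, 1 < γ i → growth γ i - 1 = 1 / (γ i - 1) := fun i hi => by
      have : γ i - 1 ≠ 0 := by linarith
      unfold growth
      field_simp
      ring
    rw [hsub _ hm1, hsub _ hg1, one_div_mul_eq_div, one_div_mul_eq_div,
      div_le_div_iff₀ (by linarith) (by linarith), hγc, hγc]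
    have := mul_le_mul_of_nonneg_left h (by linarith : 0 ≤ C)
    linarith

end ExponentialUnitWeight

/-! ### The two types of bound -/

theorem proposition7p2 (β : ℝ → ℝ → ℝ) (ω : ℝ)
    (hβ : (∃ C σ : ℝ, IsExponentialType β C σ ∧ ω ∈ ({1} : Set ℝ) ∪ Set.Ici (1 / (1 - σ))) ∨
      (∃ c : ℕ → ℝ, IsFiniteTimeType β c ∧ (∀ n, 2 ≤ n → c n = 0) ∧ 1 ≤ ω))
    (N m : ℕ) (hm : 1 ≤ m) (hmN : m ≤ N / 2 - 1) :
    alphaBound β ω N m ≤ alphaBound β ω N (m + 1) := by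
  have hmN' : 2 * m + 2 ≤ N := by omega
  have hlin : ∀ c : ℕ → ℝ, (∀ r, 0 ≤ r → ∀ n : ℕ, β r n = c n * r) →
      ∀ K, 1 ≤ K → ∀ r, 0 ≤ r → finalWeightBound β ω K r =
        (∑ n ∈ Finset.range (K - 1), c n + ω * c (K - 1)) * r := by
    intro c hc K _ r hr
    unfold finalWeightBound
    rw [hc r hr, add_mul, Finset.sum_mul, mul_assoc]
    congr 1
    exact Finset.sum_congr rfl fun n _ => hc r hr n
  -- The last hypothesis states `γ (n + 2) ≤ γ (n + 1)`.
  have hanti : ∀ c : ℕ → ℝ, 1 ≤ ω → (∀ r, 0 ≤ r → ∀ n : ℕ, β r n = c n * r) →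
      (∀ n, 1 ≤ n → c n + ω * c (n + 1) ≤ ω * c n) →
      alphaBound β ω N m ≤ alphaBound β ω N (m + 1) := by
    intro c hω hc hdec
    refine alphaBound_le_succ_of_antitone hω hm hmN' (hlin c hc) fun i j hi hij => ?_
    induction j, hij using Nat.le_induction with
    | base => rfl
    | succ j hj ih =>
      refine le_trans ?_ ih
      obtain ⟨k, rfl⟩ := Nat.exists_eq_add_of_le' (show 1 ≤ j by omega)
      have := hdec k (by omega)
      simp only [Nat.add_sub_cancel, Finset.sum_range_succ]
      linarith
  rcases hβ with ⟨C, σ, h, hω | hω⟩ | ⟨c, h, hc, hω⟩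
  · rw [Set.mem_singleton_iff] at hω
    subst hω
    refine alphaBound_le_succ_of_exponential h.sigma_mem.1 h.one_le hm hmN' fun K hK r hr => ?_
    obtain ⟨k, rfl⟩ := Nat.exists_eq_add_of_le' hK
    rw [hlin (fun n => C * σ ^ n) h.eq _ hK r hr, Nat.add_sub_cancel, geo_succ, geo, mul_add,
      Finset.mul_sum, one_mul]
  · obtain ⟨h0, h1⟩ := h.sigma_mem
    -- The weight condition amounts to `1 + ω * σ ≤ ω`, which makes `γ` nonincreasing.
    rw [Set.mem_Ici, div_le_iff₀ (by linarith)] at hω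
    have hω1 : 1 ≤ ω := by nlinarith
    refine hanti (fun n => C * σ ^ n) hω1 h.eq fun n _ => ?_
    have : 0 ≤ C * σ ^ n := mul_nonneg (by linarith [h.one_le]) (by positivity)
    have := mul_le_mul_of_nonneg_left hω this
    rw [pow_succ]
    linarith
  · refine hanti c hω h.eq fun n hn => ?_
    rw [hc (n + 1) (by omega)]
    have := h.nonneg n
    nlinarith
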